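/- **Conventions.** Matrices are complex $n\times n$, $n\ge 1$ arbitrary. $A\ge 0$ means positive semidefinite, $A>0$ positive definite, and $s(A)$ is the support projection of $A\ge 0$ (the orthogonal projection onto its range); projections are compared in the Loewner order. $A^{-1}$ is the generalized inverse of $A\ge0$ (the inverse on the support, $0$ on the kernel), and $A^{r}:=(A^{-1})^{-r}$ for $r<0$. For $\alpha>1$, $p>0$ and $A,B\ge0$ with $s(A)\ge s(B)$ put \[ A\#B:=A^{1/2}(A^{-1/2}BA^{-1/2})^{1/2}A^{1/2},\qquad F_\alpha(A,B):=(A^{-1}\#B)^{\alpha}A(A^{-1}\#B)^{\alpha}, \] \[ SG_{\alpha,p}(A,B):=F_\alpha(A^p,B^p)^{1/p},\qquad R_{\alpha,p}(A,B):=\bigl(A^{\frac{1-\alpha}{2}p}B^{\alpha p}A^{\frac{1-\alpha}{2}p}\bigr)^{1/p}. \] For $n\times n$ matrices $X,Y\ge0$ with eigenvalues $\lambda_1(X)\ge\dots\ge\lambda_n(X)$ and $\lambda_1(Y)\ge\dots\ge\lambda_n(Y)$, counted with multiplicity, $X\prec_{\log}Y$ means that $\prod_{i=1}^k\lambda_i(X)\le\prod_{i=1}^k\lambda_i(Y)$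 for $1\le k\le n$, with equality for $k=n$. **Theorem 3.4.** Let $\alpha>1$ and $p,q>0$. 1. If $p/q\le\alpha$, then $SG_{\alpha,p}(A,B)\prec_{\log}R_{\alpha,q}(A,B)$ for all $A,B\ge0$ (of the same, arbitrary size) with $s(A)\ge s(B)$. 2. There exist $2\times2$ positive definite matrices $A,B$ such that $R_{\alpha,q}(A,B)\not\prec_{\log}SG_{\alpha,p}(A,B)$. -/

import Mathlib

open scoped ComplexOrder MatrixOrder

namespace QuasiMeans

/-- `A ^ r` for a matrix `A ≥ 0` and a real exponent `r` is Mathlib's functional calculus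
`CFC.rpow`, i.e. the function `x ↦ x ^ r` on `[0, ∞)` applied to the eigenvalues of `A`. Since
`(0 : ℝ≥0) ^ r = 0` for every `r ≠ 0`, the power `A ^ (-1 : ℝ)` is the generalized inverse of `A`
(inverse on the support, zero on the kernel), and `A ^ r` for `r < 0` is the `(-r)`-th power of
the generalized inverse. The exponent `0` does not occur below for the parameters of interest.

The order `≤` on matrices is the Loewner order.

`supp A` is the support projection `s(A)` of `A ≥ 0`: the spectral projection of `A` for the set
of nonzero eigenvalues, that is, the orthogonal projection onto the range of `A`. -/
noncomputable def supp {n : ℕ} (A : Matrix (Fin n) (Fin n) ℂ) : Matrix (Fin n) (Fin n) ℂ :=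
  cfc (fun x : ℝ => if x = 0 then 0 else 1) A

/-- The weighted geometric mean `A #_t B = A^{1/2} (A^{-1/2} B A^{-1/2})^t A^{1/2}`, for
`A, B ≥ 0` with `s(A) ≥ s(B)`. -/
noncomputable def geomMean {n : ℕ} (t : ℝ) (A B : Matrix (Fin n) (Fin n) ℂ) :
    Matrix (Fin n) (Fin n) ℂ :=
  A ^ (1 / 2 : ℝ) * (A ^ (-(1 / 2) : ℝ) * B * A ^ (-(1 / 2) : ℝ)) ^ t * A ^ (1 / 2 : ℝ)

/-- The weighted spectral geometric mean `F_α(A, B) = (A⁻¹ # B)^α A (A⁻¹ # B)^α`, where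
`# = #_{1/2}` and `A⁻¹` is the generalized inverse, for `A, B ≥ 0` with `s(A) ≥ s(B)`. -/
noncomputable def specGeomMean {n : ℕ} (α : ℝ) (A B : Matrix (Fin n) (Fin n) ℂ) :
    Matrix (Fin n) (Fin n) ℂ :=
  (geomMean (1 / 2) (A ^ (-1 : ℝ)) B) ^ α * A * (geomMean (1 / 2) (A ^ (-1 : ℝ)) B) ^ α

/-- The quasi weighted spectral geometric mean `SG_{α,p}(A, B) = F_α(A^p, B^p)^{1/p}`. -/
noncomputable def SG {n : ℕ} (α p : ℝ) (A B : Matrix (Fin n) (Fin n) ℂ) :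
    Matrix (Fin n) (Fin n) ℂ :=
  (specGeomMean α (A ^ p) (B ^ p)) ^ (1 / p)

/-- The Rényi mean `R_{α,p}(A, B) = (A^{(1-α)p/2} B^{αp} A^{(1-α)p/2})^{1/p}`. -/
noncomputable def R {n : ℕ} (α p : ℝ) (A B : Matrix (Fin n) (Fin n) ℂ) :
    Matrix (Fin n) (Fin n) ℂ :=
  (A ^ ((1 - α) / 2 * p) * B ^ (α * p) * A ^ ((1 - α) / 2 * p)) ^ (1 / p)

theorem SG_posSemidef {n : ℕ} (α p : ℝ) (A B : Matrix (Fin n) (Fin n) ℂ) :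
    (SG α p A B).PosSemidef :=
  Matrix.nonneg_iff_posSemidef.mp CFC.rpow_nonneg

theorem R_posSemidef {n : ℕ} (α p : ℝ) (A B : Matrix (Fin n) (Fin n) ℂ) :
    (R α p A B).PosSemidef :=
  Matrix.nonneg_iff_posSemidef.mp CFC.rpow_nonneg

/-- The eigenvalues of a positive semidefinite matrix, with multiplicities, in decreasing order
(`Matrix.IsHermitian.eigenvalues₀` is decreasing): `eig hX 0 ≥ eig hX 1 ≥ … ≥ eig hX (n - 1)`. -/
noncomputable def eig {n : ℕ} {X : Matrix (Fin n) (Fin n) ℂ} (hX : X.PosSemidef) : Fin n → ℝ :=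
  fun i => hX.isHermitian.eigenvalues₀ (Fin.cast (Fintype.card_fin n).symm i)

/-- Log-majorization `X ≺_log Y` of positive semidefinite matrices: the product of the `k` largest
eigenvalues of `X` is at most that of `Y` for `1 ≤ k ≤ n`, with equality for `k = n`. -/
def LogMajorizedBy {n : ℕ} (X Y : Matrix (Fin n) (Fin n) ℂ)
    (hX : X.PosSemidef) (hY : Y.PosSemidef) : Prop :=
  (∀ k : ℕ, 1 ≤ k → k ≤ n →
    ∏ i : Fin n with i.val < k, eig hX i ≤ ∏ i : Fin n with i.val < k, eig hY i) ∧
  ∏ i : Fin n, eig hX i = ∏ i : Fin n, eig hY i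

end QuasiMeans

namespace QuasiMeans

open scoped Matrix.Norms.L2Operator

/-! ### Real powers of positive matrices and elementary Loewner-order moves. -/

section RealPowers

variable {n : Type*} [Fintype n] [DecidableEq n] {A B : Matrix n n ℂ}

/-! Part 1. Both means commute with compound matrices, whose norm is the product of the `k` largest
eigenvalues, so the inequalities between partial products reduce to `‖SG‖ ≤ ‖R‖`
(`norm_SG_le_norm_R`). Equality for `k = n` is multiplicativity of the determinant. Singular `A` is
replaced by `unitExtension A`, which changes neither mean because `B` lives under the support of
`A`.

Both means are homogeneous of degree `α` in `B`, so it is enough that `‖R‖ ≤ 1` implies `‖SG‖ ≤ 1`.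
The former says `B^(αq) ≤ A^((α-1)q)`; Löwner–Heinz with exponent `p/(αq) ≤ 1` gives `B^p ≤
(A^p)^(1-1/α)`. The core is then `conj_rpow_geomMean_le_one`, for `A^p` and `B^p` renamed `A` and
`B`: put `δ = 1/α` and `G = A⁻¹ # B`. The bound on `B` yields `G A^θ G ≤ A^(θ-δ)` for `0 < θ ≤ 1`.
Each conjugation by `G` thus costs `δ` in the exponent of `A`, and a total power `α` of `G` uses up
exactly `A^1`.

Part 2. Take `A = diag(1, 2)` and let `B` tend to the projection `P` onto the span of `(1, 1)`. At
`P` both norms are explicit, and strict AM–GM puts `2^((1-α)/2)` strictly between them, with `R`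
above. By continuity `R ≺_log SG` must fail for some positive definite `B` near `P`. -/

lemma finite_spectrum_real (A : Matrix n n ℂ) : (spectrum ℝ A).Finite := by
  rw [← spectrum.preimage_algebraMap ℂ]
  exact Set.Finite.preimage ((algebraMap ℝ ℂ).injective.injOn) (Matrix.finite_spectrum A)

lemma finite_spectrum_nnreal (A : Matrix n n ℂ) : (spectrum NNReal A).Finite := by
  rw [← spectrum.preimage_algebraMap ℝ]
  exact Set.Finite.preimage NNReal.coe_injective.injOn (finite_spectrum_real A)

lemma continuousOn_spectrum_nnreal (f : NNReal → NNReal) (A : Matrix n n ℂ) :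
    ContinuousOn f (spectrum NNReal A) :=
  (finite_spectrum_nnreal A).continuousOn f

lemma rpow_rpow_of_nonneg (hA : 0 ≤ A) (x y : ℝ) : (A ^ x) ^ y = A ^ (x * y) := by
  simp only [CFC.rpow_def]
  rw [← cfc_comp (R := NNReal) (fun t => t ^ y) (fun t => t ^ x) A hA
    (((finite_spectrum_nnreal A).image _).continuousOn _) (continuousOn_spectrum_nnreal _ A)]
  exact cfc_congr fun t _ => by simp [NNReal.rpow_mul]

lemma rpow_mul_rpow_of_congr {x y z : ℝ} (h : ∀ t : NNReal, t ^ x * t ^ y = t ^ z) :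
    A ^ x * A ^ y = A ^ z := by
  simp only [CFC.rpow_def]
  rw [← cfc_mul _ _ A (continuousOn_spectrum_nnreal _ A) (continuousOn_spectrum_nnreal _ A)]
  exact cfc_congr fun t _ => h t

/-- At the eigenvalue `0` both sides vanish as long as `z ≠ 0`. For `z = 0` and `x ≠ 0` the left
side is only the support projection. -/
lemma rpow_mul_rpow {x y z : ℝ} (hz : x + y = z) (h : z ≠ 0) : A ^ x * A ^ y = A ^ z :=
  rpow_mul_rpow_of_congr fun t => by rw [← hz, NNReal.rpow_add' (by rwa [hz])]

lemma rpow_mul_rpow_of_exponent_nonneg {x y z : ℝ} (hz : x + y = z) (hx : 0 ≤ x) (hy : 0 ≤ y) :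
    A ^ x * A ^ y = A ^ z :=
  rpow_mul_rpow_of_congr fun t => by rw [← hz, NNReal.rpow_add_of_nonneg t hx hy]

lemma rpow_mul_rpow_of_isStrictlyPositive (hA : IsStrictlyPositive A) {x y z : ℝ}
    (hz : x + y = z) : A ^ x * A ^ y = A ^ z := by
  rw [← hz, CFC.rpow_add hA.isUnit]

lemma rpow_isSelfAdjoint (A : Matrix n n ℂ) (x : ℝ) : IsSelfAdjoint (A ^ x) :=
  CFC.rpow_nonneg.isSelfAdjoint

lemma star_rpow (A : Matrix n n ℂ) (x : ℝ) : star (A ^ x) = A ^ x :=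
  (rpow_isSelfAdjoint A x).star_eq

lemma rpow_isStrictlyPositive (hA : IsStrictlyPositive A) (x : ℝ) :
    IsStrictlyPositive (A ^ x) :=
  (hA.isUnit.cfcRpow x hA.nonneg).isStrictlyPositive CFC.rpow_nonneg

lemma smul_rpow (hA : 0 ≤ A) {c : ℝ} (hc : 0 ≤ c) {r : ℝ} :
    (c • A) ^ r = c ^ r • A ^ r := by
  lift c to NNReal using hc
  have h : (c : ℝ) ^ r = ((c ^ r : NNReal) : ℝ) := by push_cast; rfl
  rw [h]
  change (c • A) ^ r = (c ^ r : NNReal) • A ^ r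
  simp only [CFC.rpow_def]
  rw [← cfc_smul _ _ A (continuousOn_spectrum_nnreal _ A), ← cfc_comp_smul (R := NNReal) c
    (fun t => t ^ r) A (((finite_spectrum_nnreal A).image _).continuousOn _) hA]
  exact cfc_congr fun t _ => by simp [NNReal.mul_rpow]

/-- `T` and `star T` have the same norm. This swaps the inner and outer factors of a product such as
`G A^δ G ≤ 1`. -/
lemma mul_star_self_le_one {T : Matrix n n ℂ} (h : star T * T ≤ 1) : T * star T ≤ 1 := by
  rw [← CStarAlgebra.norm_le_one_iff_of_nonneg _ (mul_star_self_nonneg T)]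
  rw [← CStarAlgebra.norm_le_one_iff_of_nonneg _ (star_mul_self_nonneg T)] at h
  rwa [CStarRing.norm_self_mul_star, ← CStarRing.norm_star_mul_self]

lemma conj_rpow_mul_conj {x : ℝ} (hA : IsStrictlyPositive A) (B : Matrix n n ℂ) :
    A ^ x * (A ^ (-x) * B * A ^ (-x)) * A ^ x = B := by
  have h1 : A ^ x * A ^ (-x) = 1 := CFC.rpow_mul_rpow_neg x hA
  have h2 : A ^ (-x) * A ^ x = 1 := CFC.rpow_neg_mul_rpow x hA
  calc _ = (A ^ x * A ^ (-x)) * B * (A ^ (-x) * A ^ x) := by noncomm_ring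
    _ = B := by rw [h1, h2, one_mul, mul_one]

lemma conj_rpow_le_one {x y : ℝ} (hA : IsStrictlyPositive A) (hxy : y = -2 * x) (h : B ≤ A ^ y) :
    A ^ x * B * A ^ x ≤ 1 := by
  refine (conjugate_le_conjugate_of_nonneg h (CFC.rpow_nonneg (y := x))).trans_eq ?_
  rw [rpow_mul_rpow_of_isStrictlyPositive hA rfl, rpow_mul_rpow_of_isStrictlyPositive hA rfl,
    show x + y + x = 0 by rw [hxy]; ring, CFC.rpow_zero A hA.nonneg]

lemma le_rpow_of_conj_le_one {x y : ℝ} (hA : IsStrictlyPositive A) (hxy : y = -2 * x)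
    (h : A ^ x * B * A ^ x ≤ 1) : B ≤ A ^ y := by
  have h1 := conjugate_le_conjugate_of_nonneg h (CFC.rpow_nonneg (a := A) (y := -x))
  have h2 := conj_rpow_mul_conj (x := -x) hA B
  rw [neg_neg] at h2
  rwa [h2, mul_one, rpow_mul_rpow_of_isStrictlyPositive hA (z := y) (by rw [hxy]; ring)] at h1

end RealPowers

/-! ### The core estimate: `B ≤ A^(1-1/α)` forces `F_α(A, B) ≤ 1`. -/

section UnitBall

variable {n : Type*} [Fintype n] [DecidableEq n] {A B V : Matrix n n ℂ}

/-- For invertible `V` one would invert the hypothesis and conjugate by `V`. To allow singular `V`,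
the contraction `T = V^γ X^(-1/2)` is used instead: `T T* = V^γ X⁻¹ V^γ ≤ 1`, conjugated by
`V^(1-γ)`. -/
lemma conj_inv_le_rpow {X : Matrix n n ℂ} (hX : IsStrictlyPositive X) (hV : 0 ≤ V) {γ : ℝ}
    (h0 : 0 ≤ γ) (h1 : γ < 1) (h : V ^ (2 * γ) ≤ X) :
    V * X ^ (-1 : ℝ) * V ≤ V ^ (2 - 2 * γ) := by
  have hle : X ^ (-(1 / 2) : ℝ) * V ^ (2 * γ) * X ^ (-(1 / 2) : ℝ) ≤ 1 :=
    conj_rpow_le_one hX (y := 1) (by norm_num) (by rwa [CFC.rpow_one X hX.nonneg])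
  have hT : star (V ^ γ * X ^ (-(1 / 2) : ℝ)) * (V ^ γ * X ^ (-(1 / 2) : ℝ)) ≤ 1 := by
    refine le_of_eq_of_le ?_ hle
    rw [star_mul, star_rpow, star_rpow,
      ← rpow_mul_rpow_of_exponent_nonneg (A := V) (z := 2 * γ) (two_mul γ).symm h0 h0]
    noncomm_ring
  have hT' := conjugate_le_conjugate_of_nonneg (mul_star_self_le_one hT)
    (CFC.rpow_nonneg (a := V) (y := 1 - γ))
  have hV1 : V ^ (1 - γ) * V ^ γ = V := by
    rw [rpow_mul_rpow (z := 1) (by ring) one_ne_zero, CFC.rpow_one V hV]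
  have hV2 : V ^ γ * V ^ (1 - γ) = V := by
    rw [rpow_mul_rpow (z := 1) (by ring) one_ne_zero, CFC.rpow_one V hV]
  have hX1 : X ^ (-(1 / 2) : ℝ) * X ^ (-(1 / 2) : ℝ) = X ^ (-1 : ℝ) :=
    rpow_mul_rpow (by norm_num) (by norm_num)
  rw [mul_one, rpow_mul_rpow (z := 2 - 2 * γ) (by ring) (by linarith)] at hT'
  refine le_of_eq_of_le ?_ hT'
  rw [star_mul, star_rpow, star_rpow]
  calc V * X ^ (-1 : ℝ) * V
      = (V ^ (1 - γ) * V ^ γ) * (X ^ (-(1 / 2) : ℝ) * X ^ (-(1 / 2) : ℝ))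
        * (V ^ γ * V ^ (1 - γ)) := by rw [hV1, hV2, hX1]
    _ = _ := by noncomm_ring

/-- Löwner–Heinz is applied twice to the hypothesis, with exponents `γ` and `1 - γ`. The choice `γ =
(1-θ)/(2-δ)` makes the first give `V^(2γ) ≤ A^(1-θ)`, as `conj_inv_le_rpow` requires; the second
bounds its output by `A^(1+θ-δ)`. -/
lemma conj_rpow_sub_one_le (hA : IsStrictlyPositive A) (hV : 0 ≤ V) {δ θ : ℝ}
    (hδ : δ ≤ 1) (hθ : 0 < θ) (hθ' : θ ≤ 1)
    (h : V ^ (2 : ℝ) ≤ A ^ (2 - δ)) : V * A ^ (θ - 1) * V ≤ A ^ (1 + θ - δ) := by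
  have hd : 0 < 2 - δ := by linarith
  set γ := (1 - θ) / (2 - δ) with hγ
  have h0 : 0 ≤ γ := div_nonneg (by linarith) hd.le
  have h1 : γ < 1 := by rw [hγ, div_lt_one hd]; linarith
  have hmul : (2 - δ) * γ = 1 - θ := by rw [hγ]; field_simp
  have hX : V ^ (2 * γ) ≤ A ^ (1 - θ) := by
    have := CFC.rpow_le_rpow (p := γ) ⟨h0, h1.le⟩ h
    rwa [rpow_rpow_of_nonneg hV, rpow_rpow_of_nonneg hA.nonneg, hmul] at this
  have hV' : V ^ (2 - 2 * γ) ≤ A ^ (1 + θ - δ) := by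
    have := CFC.rpow_le_rpow (p := 1 - γ) ⟨by linarith, by linarith⟩ h
    rwa [rpow_rpow_of_nonneg hV, rpow_rpow_of_nonneg hA.nonneg, mul_one_sub, mul_one_sub, hmul,
      show 2 - δ - (1 - θ) = 1 + θ - δ by ring] at this
  have := conj_inv_le_rpow (rpow_isStrictlyPositive hA (1 - θ)) hV h0 h1 hX
  rw [rpow_rpow_of_nonneg hA.nonneg, show (1 - θ) * -1 = θ - 1 by ring] at this
  exact this.trans hV'

/-- Induction on the integer part of the exponent. For the base case, `θ = δ` gives `G A^δ G ≤ 1`,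
which is flipped to `G^2 ≤ A^(-δ)`, raised to the power `r ≤ 1`, and flipped back. -/
lemma rpow_conj_rpow_le_one {G : Matrix n n ℂ} (hA : IsStrictlyPositive A) (hG : 0 ≤ G) {δ : ℝ}
    (hδ : 0 < δ) (hδ' : δ ≤ 1)
    (h : ∀ θ : ℝ, 0 < θ → θ ≤ 1 → G * A ^ θ * G ≤ A ^ (θ - δ)) {r : ℝ} (hr : 0 < r) (hr' : r ≤ 1)
    (j : ℕ) (hj : (j + r) * δ ≤ 1) :
    G ^ (j + r) * A ^ ((j + r) * δ) * G ^ (j + r) ≤ 1 := by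
  induction j with
  | zero =>
    rw [Nat.cast_zero, zero_add]
    have h1 : star (A ^ (δ / 2) * G) * (A ^ (δ / 2) * G) ≤ 1 := by
      refine le_of_eq_of_le ?_ ((h δ hδ hδ').trans_eq (by rw [sub_self, CFC.rpow_zero A hA.nonneg]))
      rw [star_mul, star_rpow, hG.isSelfAdjoint.star_eq,
        ← rpow_mul_rpow (A := A) (z := δ) (add_halves δ) hδ.ne']
      noncomm_ring
    have h2 : A ^ (δ / 2) * G ^ (2 : ℝ) * A ^ (δ / 2) ≤ 1 := by
      refine le_of_eq_of_le ?_ (mul_star_self_le_one h1)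
      have : G ^ (2 : ℝ) = G * G := by
        rw [← rpow_mul_rpow (x := 1) (y := 1) (by norm_num) two_ne_zero, CFC.rpow_one G hG]
      rw [star_mul, star_rpow, hG.isSelfAdjoint.star_eq, this]
      noncomm_ring
    have h3 := CFC.rpow_le_rpow (p := r) ⟨hr.le, hr'⟩
      (le_rpow_of_conj_le_one hA (y := -δ) (by ring) h2)
    rw [rpow_rpow_of_nonneg hG, rpow_rpow_of_nonneg hA.nonneg] at h3
    have h4 := conj_rpow_le_one (x := r * δ / 2) hA (by ring) h3
    have h5 : star (G ^ r * A ^ (r * δ / 2)) * (G ^ r * A ^ (r * δ / 2)) ≤ 1 := by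
      refine le_of_eq_of_le ?_ h4
      rw [star_mul, star_rpow, star_rpow,
        ← rpow_mul_rpow (A := G) (z := 2 * r) (two_mul r).symm (by positivity)]
      noncomm_ring
    refine le_of_eq_of_le ?_ (mul_star_self_le_one h5)
    rw [star_mul, star_rpow, star_rpow,
      ← rpow_mul_rpow (A := A) (z := r * δ) (add_halves (r * δ)) (by positivity)]
    noncomm_ring
  | succ j ih =>
    have hj' : ((j : ℝ) + r + 1) * δ ≤ 1 := by
      refine le_of_eq_of_le ?_ hj; push_cast; ring
    have hjr : 0 < (j : ℝ) + r := by positivity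
    have e : ((j + 1 : ℕ) : ℝ) + r = j + r + 1 := by push_cast; ring
    rw [e]
    -- Peel off one innermost `G` on each side: `θ = (j+r+1)δ` turns `G A^θ G` into at most
    -- `A^((j+r)δ)`, the middle factor of the induction hypothesis.
    have h1 := conjugate_le_conjugate_of_nonneg
      (h (((j : ℝ) + r + 1) * δ) (by positivity) hj') (CFC.rpow_nonneg (a := G) (y := j + r))
    rw [show ((j : ℝ) + r + 1) * δ - δ = (j + r) * δ by ring] at h1
    refine le_of_eq_of_le ?_ (h1.trans (ih (by nlinarith)))
    have e1 : G ^ ((j : ℝ) + r) * G = G ^ ((j : ℝ) + r + 1) := by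
      conv_lhs => rw [← CFC.rpow_one G hG, rpow_rpow_of_nonneg hG, one_mul]
      exact rpow_mul_rpow rfl (by positivity)
    have e2 : G * G ^ ((j : ℝ) + r) = G ^ ((j : ℝ) + r + 1) := by
      conv_lhs => rw [← CFC.rpow_one G hG, rpow_rpow_of_nonneg hG, one_mul]
      exact rpow_mul_rpow (by ring) (by positivity)
    rw [← e1]
    nth_rewrite 2 [e1]
    rw [← e2]
    noncomm_ring

/-- If `B ≤ A ^ (1 - 1/α)`, then `F_α(A, B) ≤ 1`. -/
theorem conj_rpow_geomMean_le_one (hA : IsStrictlyPositive A) (hB : 0 ≤ B) {α : ℝ} (hα : 1 < α)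
    (h : B ≤ A ^ (1 - 1 / α)) {G : Matrix n n ℂ}
    (hG : G = A ^ (-(1 / 2) : ℝ) * (A ^ (1 / 2 : ℝ) * B * A ^ (1 / 2 : ℝ)) ^ (1 / 2 : ℝ)
      * A ^ (-(1 / 2) : ℝ)) :
    G ^ α * A * G ^ α ≤ 1 := by
  have hα0 : 0 < α := by linarith
  set W := A ^ (1 / 2 : ℝ) * B * A ^ (1 / 2 : ℝ) with hW
  have hW0 : 0 ≤ W := conjugate_nonneg_of_nonneg hB CFC.rpow_nonneg
  have hV : 0 ≤ W ^ (1 / 2 : ℝ) := CFC.rpow_nonneg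
  have hG0 : 0 ≤ G := hG ▸ conjugate_nonneg_of_nonneg hV CFC.rpow_nonneg
  have hV2 : (W ^ (1 / 2 : ℝ)) ^ (2 : ℝ) ≤ A ^ (2 - 1 / α) := by
    rw [rpow_rpow_of_nonneg hW0, show (1 / 2 : ℝ) * 2 = 1 by norm_num, CFC.rpow_one W hW0]
    refine (conjugate_le_conjugate_of_nonneg h CFC.rpow_nonneg).trans_eq ?_
    rw [rpow_mul_rpow_of_isStrictlyPositive hA rfl, rpow_mul_rpow_of_isStrictlyPositive hA rfl]
    congr 1; ring
  have hδ : 0 < 1 / α := by positivity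
  have hδ' : 1 / α ≤ 1 := by rw [div_le_one hα0]; exact hα.le
  have key : ∀ θ : ℝ, 0 < θ → θ ≤ 1 → G * A ^ θ * G ≤ A ^ (θ - 1 / α) := by
    intro θ hθ hθ'
    have h1 := conjugate_le_conjugate_of_nonneg (conj_rpow_sub_one_le hA hV hδ' hθ hθ' hV2)
      (CFC.rpow_nonneg (a := A) (y := -(1 / 2)))
    rw [rpow_mul_rpow_of_isStrictlyPositive hA rfl, rpow_mul_rpow_of_isStrictlyPositive hA rfl,
      show -(1 / 2) + (1 + θ - 1 / α) + -(1 / 2) = θ - 1 / α by ring] at h1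
    refine le_of_eq_of_le ?_ h1
    have : A ^ (-(1 / 2) : ℝ) * A ^ θ * A ^ (-(1 / 2) : ℝ) = A ^ (θ - 1) := by
      rw [rpow_mul_rpow_of_isStrictlyPositive hA rfl, rpow_mul_rpow_of_isStrictlyPositive hA rfl]
      congr 1; ring
    rw [← this, hG]
    noncomm_ring
  -- `j = ⌈α⌉ - 1` rather than the floor, so that `r` is positive; integer `α` gets `r = 1`.
  obtain ⟨j, r, hr, hr', hjr⟩ : ∃ (j : ℕ) (r : ℝ), 0 < r ∧ r ≤ 1 ∧ (j : ℝ) + r = α := by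
    refine ⟨⌈α⌉₊ - 1, α - (⌈α⌉₊ - 1 : ℕ), ?_, ?_, by ring⟩
    · have h1 : 1 ≤ ⌈α⌉₊ := Nat.one_le_ceil_iff.mpr hα0
      have h2 := Nat.ceil_lt_add_one hα0.le
      push_cast [Nat.cast_sub h1]; linarith
    · have h1 : 1 ≤ ⌈α⌉₊ := Nat.one_le_ceil_iff.mpr hα0
      have h2 := Nat.le_ceil α
      push_cast [Nat.cast_sub h1]; linarith
  have hone : ((j : ℝ) + r) * (1 / α) = 1 := by rw [hjr]; field_simp
  have := rpow_conj_rpow_le_one hA hG0 hδ hδ' key hr hr' j hone.le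
  rwa [hone, hjr, CFC.rpow_one A hA.nonneg] at this

end UnitBall

/-! ### Homogeneity in `B` and the operator norm inequality. -/

section NormInequality

variable {n : ℕ} {A B : Matrix (Fin n) (Fin n) ℂ}

lemma geomMean_nonneg (t : ℝ) (A : Matrix (Fin n) (Fin n) ℂ) (B : Matrix (Fin n) (Fin n) ℂ) :
    0 ≤ geomMean t A B :=
  conjugate_nonneg_of_nonneg CFC.rpow_nonneg CFC.rpow_nonneg

lemma geomMean_half_inv (hA : 0 ≤ A) :
    geomMean (1 / 2) (A ^ (-1 : ℝ)) B = A ^ (-(1 / 2) : ℝ) *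
      (A ^ (1 / 2 : ℝ) * B * A ^ (1 / 2 : ℝ)) ^ (1 / 2 : ℝ) * A ^ (-(1 / 2) : ℝ) := by
  rw [geomMean, rpow_rpow_of_nonneg hA, rpow_rpow_of_nonneg hA]
  norm_num

lemma geomMean_smul (t : ℝ) (hB : 0 ≤ B) {c : ℝ} (hc : 0 ≤ c) :
    geomMean t A (c • B) = c ^ t • geomMean t A B := by
  have h : 0 ≤ A ^ (-(1 / 2) : ℝ) * B * A ^ (-(1 / 2) : ℝ) :=
    conjugate_nonneg_of_nonneg hB CFC.rpow_nonneg
  simp only [geomMean, mul_smul_comm, smul_mul_assoc, smul_rpow h hc]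

lemma specGeomMean_smul {α : ℝ} (hα : 0 < α) (hB : 0 ≤ B) {c : ℝ} (hc : 0 ≤ c) :
    specGeomMean α A (c • B) = c ^ α • specGeomMean α A B := by
  rw [specGeomMean, geomMean_smul _ hB hc,
    smul_rpow (geomMean_nonneg _ _ _) (Real.rpow_nonneg hc _), ← Real.rpow_mul hc]
  simp only [specGeomMean, smul_mul_assoc, mul_smul_comm, smul_smul]
  rw [← Real.rpow_add_of_nonneg hc (by positivity) (by positivity)]
  congr 2; ring

lemma specGeomMean_nonneg (α : ℝ) (hA : 0 ≤ A) (B : Matrix (Fin n) (Fin n) ℂ) :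
    0 ≤ specGeomMean α A B :=
  conjugate_nonneg_of_nonneg hA CFC.rpow_nonneg

lemma SG_smul {α p : ℝ} (hα : 0 < α) (hp : 0 < p) (hB : 0 ≤ B) {c : ℝ} (hc : 0 ≤ c) :
    SG α p A (c • B) = c ^ α • SG α p A B := by
  rw [SG, SG, smul_rpow hB hc, specGeomMean_smul hα CFC.rpow_nonneg (Real.rpow_nonneg hc _),
    smul_rpow (specGeomMean_nonneg α CFC.rpow_nonneg _) (by positivity),
    ← Real.rpow_mul hc, ← Real.rpow_mul hc]
  congr 2; field_simp

lemma R_smul {α q : ℝ} (hq : 0 < q) (hB : 0 ≤ B) {c : ℝ} (hc : 0 ≤ c) :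
    R α q A (c • B) = c ^ α • R α q A B := by
  have h : 0 ≤ A ^ ((1 - α) / 2 * q) * B ^ (α * q) * A ^ ((1 - α) / 2 * q) :=
    conjugate_nonneg_of_nonneg CFC.rpow_nonneg CFC.rpow_nonneg
  rw [R, R, smul_rpow hB hc, mul_smul_comm, smul_mul_assoc, smul_rpow h (by positivity),
    ← Real.rpow_mul hc]
  congr 2; field_simp

lemma norm_SG_le_one_of_norm_R_le_one (hA : IsStrictlyPositive A) (hB : 0 ≤ B) {α p q : ℝ} (hα : 1 < α)
    (hp : 0 < p) (hq : 0 < q) (hpq : p / q ≤ α) (h : ‖R α q A B‖ ≤ 1) : ‖SG α p A B‖ ≤ 1 := by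
  have hα0 : 0 < α := by linarith
  have hR0 : 0 ≤ A ^ ((1 - α) / 2 * q) * B ^ (α * q) * A ^ ((1 - α) / 2 * q) :=
    conjugate_nonneg_of_nonneg CFC.rpow_nonneg CFC.rpow_nonneg
  rw [R, CFC.norm_rpow _ (by positivity) hR0] at h
  have h1 : ‖A ^ ((1 - α) / 2 * q) * B ^ (α * q) * A ^ ((1 - α) / 2 * q)‖ ≤ 1 := by
    by_contra! hlt
    exact absurd h (not_le.mpr (Real.one_lt_rpow hlt (by positivity)))
  rw [CStarAlgebra.norm_le_one_iff_of_nonneg _ hR0] at h1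
  -- The only use of `p/q ≤ α`: it puts the exponent in the Löwner–Heinz range.
  have h2 := CFC.rpow_le_rpow (p := p / (α * q)) ⟨by positivity, by
    rw [div_le_one (by positivity)]; rwa [div_le_iff₀ hq] at hpq⟩
    (le_rpow_of_conj_le_one hA (y := (α - 1) * q) (by ring) h1)
  rw [rpow_rpow_of_nonneg hB, rpow_rpow_of_nonneg hA.nonneg,
    show α * q * (p / (α * q)) = p by field_simp,
    show (α - 1) * q * (p / (α * q)) = p * (1 - 1 / α) by field_simp,
    ← rpow_rpow_of_nonneg hA.nonneg] at h2
  have h3 : specGeomMean α (A ^ p) (B ^ p) ≤ 1 :=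
    conj_rpow_geomMean_le_one (rpow_isStrictlyPositive hA p) CFC.rpow_nonneg hα h2
      (geomMean_half_inv CFC.rpow_nonneg)
  have h4 := specGeomMean_nonneg α (CFC.rpow_nonneg (a := A) (y := p)) (B ^ p)
  rw [SG, CFC.norm_rpow _ (by positivity) h4]
  exact Real.rpow_le_one (norm_nonneg _) ((CStarAlgebra.norm_le_one_iff_of_nonneg _ h4).mpr h3)
    (by positivity)

theorem norm_SG_le_norm_R (hA : IsStrictlyPositive A) (hB : 0 ≤ B) {α p q : ℝ} (hα : 1 < α)
    (hp : 0 < p) (hq : 0 < q) (hpq : p / q ≤ α) : ‖SG α p A B‖ ≤ ‖R α q A B‖ := by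
  have hα0 : 0 < α := by linarith
  refine le_of_forall_gt_imp_ge_of_dense fun t ht => ?_
  have ht0 : 0 < t := (norm_nonneg _).trans_lt ht
  -- Scaling `B` by `c` divides both means by `t`. Taking `t > ‖R‖` instead of `t = ‖R‖` covers `R =
  -- 0`.
  set c := (t⁻¹) ^ (1 / α) with hc
  have hc0 : 0 ≤ c := by positivity
  have hcα : c ^ α = t⁻¹ := by
    rw [hc, ← Real.rpow_mul (by positivity), one_div_mul_cancel hα0.ne', Real.rpow_one]
  have h := norm_SG_le_one_of_norm_R_le_one hA (smul_nonneg hc0 hB) hα hp hq hpq (B := c • B)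
  rw [R_smul hq hB hc0, SG_smul hα0 hp hB hc0, hcα, norm_smul, norm_smul,
    Real.norm_of_nonneg (by positivity), inv_mul_le_one₀ ht0, inv_mul_le_one₀ ht0] at h
  exact h ht.le

end NormInequality

/-! ### Reduction to invertible `A`. -/

section SupportReduction

variable {n : ℕ} {A B : Matrix (Fin n) (Fin n) ℂ}

lemma supp_isStarProjection (A : Matrix (Fin n) (Fin n) ℂ) : IsStarProjection (supp A) := by
  refine ⟨?_, cfc_predicate _ A⟩
  have hf := finite_spectrum_real A
  rw [IsIdempotentElem, supp, ← cfc_mul _ _ A (hf.continuousOn _) (hf.continuousOn _)]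
  exact cfc_congr fun t _ => by simp

lemma supp_mul_self (hA : 0 ≤ A) : supp A * A = A := by
  have hf := finite_spectrum_real A
  have h := cfc_mul (fun t : ℝ => if t = 0 then 0 else 1) id A (hf.continuousOn _)
    (hf.continuousOn _)
  rw [cfc_id ℝ A hA.isSelfAdjoint] at h
  refine h.symm.trans ((cfc_congr fun t _ => ?_).trans (cfc_id ℝ A hA.isSelfAdjoint))
  by_cases h : t = 0 <;> simp [h]

/-- `A` is extended by the identity on its kernel. -/
noncomputable def unitExtension (A : Matrix (Fin n) (Fin n) ℂ) : Matrix (Fin n) (Fin n) ℂ :=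
  cfc (fun x : NNReal => if x = 0 then 1 else x) A

lemma supp_eq_cfc_nnreal (hA : 0 ≤ A) :
    supp A = cfc (fun x : NNReal => if x = 0 then (0 : NNReal) else 1) A := by
  rw [supp, cfc_nnreal_eq_real _ A hA]
  refine cfc_congr fun t ht => ?_
  have : 0 ≤ t := spectrum_nonneg_of_nonneg hA ht
  by_cases h : t = 0
  · simp [h]
  · have : ¬ t ≤ 0 := fun h' => h (le_antisymm h' this)
    simp [h, this]

lemma unitExtension_isStrictlyPositive (hA : 0 ≤ A) : IsStrictlyPositive (unitExtension A) := by
  refine IsUnit.isStrictlyPositive ?_ (cfc_predicate _ A)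
  rw [unitExtension, isUnit_cfc_iff _ A (continuousOn_spectrum_nnreal _ A) hA]
  intro t _
  by_cases h : t = 0 <;> simp [h]

lemma unitExtension_rpow_mul_supp (hA : 0 ≤ A) {x : ℝ} (hx : x ≠ 0) :
    unitExtension A ^ x * supp A = A ^ x := by
  rw [supp_eq_cfc_nnreal hA, unitExtension, CFC.rpow_def, CFC.rpow_def,
    ← cfc_comp (R := NNReal) (fun t => t ^ x) _ A hA
      (((finite_spectrum_nnreal A).image _).continuousOn _) (continuousOn_spectrum_nnreal _ A),
    ← cfc_mul _ _ A (continuousOn_spectrum_nnreal _ A) (continuousOn_spectrum_nnreal _ A)]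
  refine cfc_congr fun t _ => ?_
  by_cases h : t = 0 <;> simp [h, hx]

lemma supp_mul_unitExtension_rpow (hA : 0 ≤ A) {x : ℝ} (hx : x ≠ 0) :
    supp A * unitExtension A ^ x = A ^ x := by
  have := congrArg star (unitExtension_rpow_mul_supp hA hx)
  rwa [star_mul, star_rpow, star_rpow, (supp_isStarProjection A).isSelfAdjoint.star_eq] at this

lemma mul_rpow_of_mul_eq {P : Matrix (Fin n) (Fin n) ℂ} (hA : 0 ≤ A) (h : P * A = A) {x : ℝ}
    (hx : x ≠ 0) : P * A ^ x = A ^ x := by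
  have : A * A ^ (x - 1) = A ^ x := by
    conv_lhs => rw [← CFC.rpow_one A hA, rpow_rpow_of_nonneg hA, one_mul]
    exact rpow_mul_rpow (by ring) hx
  rw [← this, ← mul_assoc, h]

lemma rpow_mul_of_mul_eq {P : Matrix (Fin n) (Fin n) ℂ} (hP : IsSelfAdjoint P) (hA : 0 ≤ A)
    (h : P * A = A) {x : ℝ} (hx : x ≠ 0) : A ^ x * P = A ^ x := by
  have := congrArg star (mul_rpow_of_mul_eq hA h hx)
  rwa [star_mul, star_rpow, hP.star_eq] at this

lemma unitExtension_conj (hA : 0 ≤ A) {X : Matrix (Fin n) (Fin n) ℂ} (h1 : supp A * X = X)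
    (h2 : X * supp A = X) {x : ℝ} (hx : x ≠ 0) :
    unitExtension A ^ x * X * unitExtension A ^ x = A ^ x * X * A ^ x := by
  calc _ = unitExtension A ^ x * (supp A * X * supp A) * unitExtension A ^ x := by rw [h1, h2]
    _ = (unitExtension A ^ x * supp A) * X * (supp A * unitExtension A ^ x) := by noncomm_ring
    _ = _ := by rw [unitExtension_rpow_mul_supp hA hx, supp_mul_unitExtension_rpow hA hx]

lemma supp_mul_of_supp_le (hB : 0 ≤ B) (h : supp B ≤ supp A) : supp A * B = B := by
  have := ((supp_isStarProjection A).mul_right_and_mul_left_of_nonneg_of_le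
    (supp_isStarProjection B).nonneg h).2
  rw [← supp_mul_self hB, ← mul_assoc, this]

lemma R_unitExtension (hA : 0 ≤ A) (hB : 0 ≤ B) (h : supp B ≤ supp A) {α q : ℝ} (hα : 1 < α)
    (hq : 0 < q) : R α q (unitExtension A) B = R α q A B := by
  have hAB := supp_mul_of_supp_le hB h
  have hx : α * q ≠ 0 := by positivity
  have hy : (1 - α) / 2 * q ≠ 0 :=
    mul_ne_zero (div_ne_zero (by linarith) two_ne_zero) hq.ne'
  rw [R, R, unitExtension_conj hA (mul_rpow_of_mul_eq hB hAB hx)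
    (rpow_mul_of_mul_eq (supp_isStarProjection A).isSelfAdjoint hB hAB hx) hy]

lemma SG_unitExtension (hA : 0 ≤ A) (hB : 0 ≤ B) (h : supp B ≤ supp A) {α p : ℝ} (hα : 1 < α)
    (hp : 0 < p) : SG α p (unitExtension A) B = SG α p A B := by
  have hP := (supp_isStarProjection A).isSelfAdjoint
  have hA' := (unitExtension_isStrictlyPositive hA).nonneg
  have hAB := supp_mul_of_supp_le hB h
  have hB1 := mul_rpow_of_mul_eq hB hAB hp.ne'
  have hB2 := rpow_mul_of_mul_eq hP hB hAB hp.ne'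
  set M := A ^ (p * (1 / 2)) * B ^ p * A ^ (p * (1 / 2)) with hM
  have hM0 : 0 ≤ M := conjugate_nonneg_of_nonneg CFC.rpow_nonneg CFC.rpow_nonneg
  have hPA (x : ℝ) (hx : x ≠ 0) : supp A * A ^ x = A ^ x :=
    mul_rpow_of_mul_eq hA (supp_mul_self hA) hx
  have hPM : supp A * M = M := by
    rw [hM, ← mul_assoc, ← mul_assoc, hPA _ (by positivity)]
  have hG : geomMean (1 / 2) ((unitExtension A ^ p) ^ (-1 : ℝ)) (B ^ p)
      = geomMean (1 / 2) ((A ^ p) ^ (-1 : ℝ)) (B ^ p) := by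
    rw [geomMean_half_inv CFC.rpow_nonneg, geomMean_half_inv CFC.rpow_nonneg]
    simp only [rpow_rpow_of_nonneg hA, rpow_rpow_of_nonneg hA']
    rw [unitExtension_conj hA hB1 hB2 (by positivity), ← hM,
      unitExtension_conj hA (mul_rpow_of_mul_eq hM0 hPM (by norm_num))
        (rpow_mul_of_mul_eq hP hM0 hPM (by norm_num)) (by simp [hp.ne'])]
  set G := geomMean (1 / 2) ((A ^ p) ^ (-1 : ℝ)) (B ^ p) with hG'
  have hPG : supp A * G = G := by
    rw [hG', geomMean_half_inv CFC.rpow_nonneg]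
    simp only [rpow_rpow_of_nonneg hA, ← mul_assoc]
    rw [hPA _ (by simp [hp.ne'])]
  have hα0 : α ≠ 0 := by positivity
  have h1 : supp A * G ^ α = G ^ α := mul_rpow_of_mul_eq (geomMean_nonneg _ _ _) hPG hα0
  rw [SG, SG, specGeomMean, specGeomMean, hG, ← hG']
  congr 1
  -- Insert the support projection next to the middle factor, where it turns the power of
  -- `unitExtension A` into `A^p`.
  nth_rewrite 2 [← h1]
  rw [mul_assoc, ← mul_assoc (unitExtension A ^ p), unitExtension_rpow_mul_supp hA hp.ne',
    mul_assoc]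

end SupportReduction

/-! ### Functional calculus through an arbitrary unitary diagonalization. -/

section Diagonalization

open Matrix

variable {n : Type*} [Fintype n] [DecidableEq n]

lemma cfc_unitary_conj_diagonal {V : Matrix n n ℂ} (hV : V ∈ unitary (Matrix n n ℂ)) (d : n → ℝ)
    (f : ℝ → ℝ) : cfc f (V * diagonal (fun i => (d i : ℂ)) * star V)
      = V * diagonal (fun i => (f (d i) : ℂ)) * star V := by
  set A := V * diagonal (fun i => (d i : ℂ)) * star V with hAV
  have hA : A.IsHermitian := by
    rw [hAV, IsHermitian, conjTranspose_mul, conjTranspose_mul, star_eq_conjTranspose,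
      conjTranspose_conjTranspose, diagonal_conjTranspose, ← mul_assoc]
    congr 3
    ext i
    simp
  obtain ⟨hV1, hV2⟩ := Unitary.mem_iff.mp hV
  set U : Matrix n n ℂ := hA.eigenvectorUnitary.1
  have hU1 : star U * U = 1 := Unitary.coe_star_mul_self hA.eigenvectorUnitary
  have hU2 : U * star U = 1 := Unitary.coe_mul_star_self hA.eigenvectorUnitary
  have hspec : A = U * diagonal (fun i => (hA.eigenvalues i : ℂ)) * star U := by
    conv_lhs => rw [hA.spectral_theorem, Unitary.conjStarAlgAut_apply]
    rfl
  have hcfc : cfc f A = U * diagonal (fun i => (f (hA.eigenvalues i) : ℂ)) * star U := by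
    rw [hA.cfc_eq, IsHermitian.cfc, Unitary.conjStarAlgAut_apply]
    rfl
  have hW : star U * V * diagonal (fun i => (d i : ℂ))
      = diagonal (fun i => (hA.eigenvalues i : ℂ)) * (star U * V) := by
    calc star U * V * diagonal (fun i => (d i : ℂ))
        = star U * (V * diagonal (fun i => (d i : ℂ)) * star V) * V := by
          simp only [mul_assoc, hV1, mul_one]
      _ = star U * (U * diagonal (fun i => (hA.eigenvalues i : ℂ)) * star U) * V := by
          rw [← hAV, ← hspec]
      _ = (star U * U) * diagonal (fun i => (hA.eigenvalues i : ℂ)) * (star U * V) := by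
          simp only [mul_assoc]
      _ = _ := by rw [hU1, one_mul]
  -- Entrywise, the intertwiner `star U * V` is nonzero only where the two eigenvalues agree, so it
  -- also intertwines their images under `f`.
  have hWf : star U * V * diagonal (fun i => (f (d i) : ℂ))
      = diagonal (fun i => (f (hA.eigenvalues i) : ℂ)) * (star U * V) := by
    ext i j
    have h := congrFun (congrFun hW i) j
    rw [mul_diagonal, diagonal_mul] at h ⊢
    rcases eq_or_ne ((star U * V) i j) 0 with h0 | h0
    · simp [h0]
    · have : d j = hA.eigenvalues i := by
        rw [mul_comm] at h
        exact_mod_cast mul_right_cancel₀ h0 h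
      rw [this, mul_comm]
  rw [hcfc]
  calc U * diagonal (fun i => (f (hA.eigenvalues i) : ℂ)) * star U
      = U * (diagonal (fun i => (f (hA.eigenvalues i) : ℂ)) * (star U * V)) * star V := by
        simp only [mul_assoc, hV2, mul_one]
    _ = (U * star U) * V * diagonal (fun i => (f (d i) : ℂ)) * star V := by
        rw [← hWf]; simp only [mul_assoc]
    _ = _ := by rw [hU2, one_mul]

lemma unitary_conj_diagonal_nonneg (V : Matrix n n ℂ) {d : n → ℝ} (hd : 0 ≤ d) :
    0 ≤ V * diagonal (fun i => (d i : ℂ)) * star V := by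
  refine star_right_conjugate_nonneg ?_ V
  rw [nonneg_iff_posSemidef, posSemidef_diagonal_iff]
  exact fun i => by exact_mod_cast hd i

lemma unitary_conj_diagonal_rpow {V : Matrix n n ℂ} (hV : V ∈ unitary (Matrix n n ℂ)) {d : n → ℝ}
    (hd : 0 ≤ d) (r : ℝ) : (V * diagonal (fun i => (d i : ℂ)) * star V) ^ r
      = V * diagonal (fun i => ((d i ^ r : ℝ) : ℂ)) * star V := by
  rw [CFC.rpow_eq_cfc_real (unitary_conj_diagonal_nonneg V hd), cfc_unitary_conj_diagonal hV]

end Diagonalization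

/-! ### Ordered eigenvalues and determinants of the two means. -/

section Eigenvalues

open Matrix

variable {n : ℕ} {X : Matrix (Fin n) (Fin n) ℂ}

lemma eig_antitone (hX : X.PosSemidef) : Antitone (eig hX) := fun _ _ hij =>
  hX.isHermitian.eigenvalues₀_antitone (by simpa using hij)

lemma exists_unitary_eig (hX : X.PosSemidef) : ∃ V ∈ unitary (Matrix (Fin n) (Fin n) ℂ),
    X = V * diagonal (fun i => (eig hX i : ℂ)) * star V := by
  set U : Matrix (Fin n) (Fin n) ℂ := hX.isHermitian.eigenvectorUnitary.1
  have hU1 : star U * U = 1 := Unitary.coe_star_mul_self hX.isHermitian.eigenvectorUnitary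
  have hspec : X = U * diagonal (fun i => (hX.isHermitian.eigenvalues i : ℂ)) * star U := by
    conv_lhs => rw [hX.isHermitian.spectral_theorem, Unitary.conjStarAlgAut_apply]
    rfl
  let π : Fin n ≃ Fin n := (finCongr (Fintype.card_fin n).symm).trans
    (Fintype.equivOfCardEq (Fintype.card_fin _))
  have heig (i : Fin n) : eig hX i = hX.isHermitian.eigenvalues (π i) := by
    simp [eig, IsHermitian.eigenvalues, π]
  have hV : star (U.submatrix id π) * U.submatrix id π = 1 := by
    rw [star_eq_conjTranspose, conjTranspose_submatrix,
      ← submatrix_mul _ _ _ id _ Function.bijective_id, ← star_eq_conjTranspose, hU1,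
      submatrix_one_equiv]
  refine ⟨U.submatrix id π, Unitary.mem_iff.mpr ⟨hV, mul_eq_one_comm.mp hV⟩, ?_⟩
  have hd : diagonal (fun i => (eig hX i : ℂ))
      = (diagonal (fun i => (hX.isHermitian.eigenvalues i : ℂ))).submatrix π π := by
    rw [submatrix_diagonal_equiv]
    simp only [heig]
    rfl
  rw [hd, star_eq_conjTranspose, conjTranspose_submatrix, submatrix_mul_equiv,
    submatrix_mul_equiv, ← star_eq_conjTranspose, submatrix_id_id]
  exact hspec

lemma eig_nonneg (hX : X.PosSemidef) : 0 ≤ eig hX := fun i => by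
  obtain ⟨V, hV, h⟩ := exists_unitary_eig hX
  have h1 : star V * X * V = diagonal (fun i => (eig hX i : ℂ)) := by
    conv_lhs => rw [h]
    simp only [mul_assoc, (Unitary.mem_iff.mp hV).1, mul_one]
    rw [← mul_assoc, (Unitary.mem_iff.mp hV).1, one_mul]
  have h2 : (diagonal (fun i => (eig hX i : ℂ))).PosSemidef := by
    rw [← h1, star_eq_conjTranspose]
    exact hX.conjTranspose_mul_mul_same V
  rw [posSemidef_diagonal_iff] at h2
  exact_mod_cast h2 i

lemma norm_det_unitary_conj_diagonal {V : Matrix (Fin n) (Fin n) ℂ}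
    (hV : V ∈ unitary (Matrix (Fin n) (Fin n) ℂ)) {d : Fin n → ℝ} (hd : 0 ≤ d) :
    ‖(V * diagonal (fun i => (d i : ℂ)) * star V).det‖ = ∏ i, d i := by
  rw [det_mul_comm, ← mul_assoc, (Unitary.mem_iff.mp hV).1, one_mul, det_diagonal, norm_prod]
  exact Finset.prod_congr rfl fun i _ => by simp [abs_of_nonneg (hd i)]

lemma norm_det_eq_prod_eig (hX : X.PosSemidef) : ‖X.det‖ = ∏ i, eig hX i := by
  obtain ⟨V, hV, h⟩ := exists_unitary_eig hX
  conv_lhs => rw [h]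
  exact norm_det_unitary_conj_diagonal hV (eig_nonneg hX)

lemma norm_det_rpow (hX : 0 ≤ X) (r : ℝ) : ‖(X ^ r).det‖ = ‖X.det‖ ^ r := by
  obtain ⟨V, hV, h⟩ := exists_unitary_eig (nonneg_iff_posSemidef.mp hX)
  have h0 := eig_nonneg (nonneg_iff_posSemidef.mp hX)
  rw [h, unitary_conj_diagonal_rpow hV h0, norm_det_unitary_conj_diagonal hV h0,
    norm_det_unitary_conj_diagonal hV fun i => Real.rpow_nonneg (h0 i) r,
    Real.finsetProd_rpow _ _ fun i _ => h0 i]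

lemma norm_det_R {A B : Matrix (Fin n) (Fin n) ℂ} (hA : IsStrictlyPositive A) (hB : 0 ≤ B)
    {α q : ℝ} (hq : 0 < q) : ‖(R α q A B).det‖ = ‖A.det‖ ^ (1 - α) * ‖B.det‖ ^ α := by
  have h : 0 ≤ A ^ ((1 - α) / 2 * q) * B ^ (α * q) * A ^ ((1 - α) / 2 * q) :=
    conjugate_nonneg_of_nonneg CFC.rpow_nonneg CFC.rpow_nonneg
  have ha : 0 < ‖A.det‖ := norm_pos_iff.mpr ((isUnit_iff_isUnit_det A).mp hA.isUnit).ne_zero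
  have hb : 0 ≤ ‖B.det‖ := norm_nonneg _
  rw [R, norm_det_rpow h, det_mul, det_mul, norm_mul, norm_mul, norm_det_rpow hA.nonneg,
    norm_det_rpow hB, mul_right_comm, ← Real.rpow_add ha, Real.mul_rpow (by positivity)
    (by positivity), ← Real.rpow_mul ha.le, ← Real.rpow_mul hb]
  congr 2 <;> field_simp
  ring

lemma rpow_conj_mul_rpow {a b α p : ℝ} (ha : 0 < a) (hb : 0 ≤ b) (hα : 0 < α) (hp : 0 < p) :
    (a ^ (-(p / 2) * α) * b ^ (p / 2 * α) * a ^ p * (a ^ (-(p / 2) * α) * b ^ (p / 2 * α))) ^ (1 / p)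
      = a ^ (1 - α) * b ^ α := by
  rw [show ∀ x y z : ℝ, x * y * z * (x * y) = (x * z * x) * (y * y) by intros; ring,
    ← Real.rpow_add ha, ← Real.rpow_add ha,
    ← Real.rpow_add_of_nonneg hb (by positivity) (by positivity),
    Real.mul_rpow (by positivity) (by positivity), ← Real.rpow_mul ha.le, ← Real.rpow_mul hb]
  congr 2 <;> (field_simp; ring)

lemma norm_det_SG {A B : Matrix (Fin n) (Fin n) ℂ} (hA : IsStrictlyPositive A) (hB : 0 ≤ B)
    {α p : ℝ} (hα : 0 < α) (hp : 0 < p) : ‖(SG α p A B).det‖ = ‖A.det‖ ^ (1 - α) * ‖B.det‖ ^ α := by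
  have ha : 0 < ‖A.det‖ := norm_pos_iff.mpr ((isUnit_iff_isUnit_det A).mp hA.isUnit).ne_zero
  have hb : 0 ≤ ‖B.det‖ := norm_nonneg _
  have hM : 0 ≤ A ^ (p * (1 / 2)) * B ^ p * A ^ (p * (1 / 2)) :=
    conjugate_nonneg_of_nonneg CFC.rpow_nonneg CFC.rpow_nonneg
  have hG : ‖(geomMean (1 / 2) ((A ^ p) ^ (-1 : ℝ)) (B ^ p)).det‖
      = ‖A.det‖ ^ (-(p / 2)) * ‖B.det‖ ^ (p / 2) := by
    rw [geomMean_half_inv CFC.rpow_nonneg]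
    simp only [rpow_rpow_of_nonneg hA.nonneg]
    rw [det_mul, det_mul, norm_mul, norm_mul, norm_det_rpow hM, det_mul, det_mul, norm_mul,
      norm_mul]
    simp only [norm_det_rpow hA.nonneg, norm_det_rpow hB]
    rw [mul_right_comm (‖A.det‖ ^ (p * (1 / 2))), ← Real.rpow_add ha,
      Real.mul_rpow (by positivity) (by positivity), ← Real.rpow_mul ha.le, ← Real.rpow_mul hb,
      mul_right_comm, ← mul_assoc, ← Real.rpow_add ha, ← Real.rpow_add ha]
    congr 2 <;> ring
  rw [SG, norm_det_rpow (specGeomMean_nonneg α CFC.rpow_nonneg _), specGeomMean, det_mul, det_mul,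
    norm_mul, norm_mul, norm_det_rpow (geomMean_nonneg _ _ _), hG, norm_det_rpow hA.nonneg,
    Real.mul_rpow (x := ‖A.det‖ ^ (-(p / 2))) (by positivity) (by positivity), ← Real.rpow_mul ha.le,
    ← Real.rpow_mul hb, rpow_conj_mul_rpow ha hb hα hp]

end Eigenvalues

/-! ### Compound matrices and log-majorization. -/

section Compound

open Matrix

variable {n : ℕ} {A B : Matrix (Fin n) (Fin n) ℂ}

/-- The **Cauchy–Binet formula**. -/
theorem det_mul_eq_sum_orderEmbedding {R : Type*} [CommRing R] {k : ℕ}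
    (M : Matrix (Fin k) (Fin n) R) (N : Matrix (Fin n) (Fin k) R) :
    (M * N).det = ∑ e : Fin k ↪o Fin n, (M.submatrix id e).det * (N.submatrix e id).det := by
  have h1 : (M * N).det = ∑ p : Fin k → Fin n, (M.submatrix id p).det * ∏ i, N (p i) i := by
    simp only [det_apply', mul_apply, Finset.prod_univ_sum, Finset.mul_sum, Finset.sum_mul,
      Fintype.piFinset_univ]
    rw [Finset.sum_comm]
    exact Finset.sum_congr rfl fun p _ => Finset.sum_congr rfl fun σ _ => by
      rw [Finset.prod_mul_distrib, mul_assoc]; rfl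
  have h2 : ∑ p : Fin k → Fin n with Function.Injective p,
      (M.submatrix id p).det * ∏ i, N (p i) i
        = ∑ p : Fin k → Fin n, (M.submatrix id p).det * ∏ i, N (p i) i := by
    refine Finset.sum_subset (Finset.filter_subset _ _) fun p _ hp => ?_
    have hp' : ¬ Function.Injective p := by simpa using hp
    simp only [Function.Injective, not_forall] at hp'
    obtain ⟨i, j, hij, hne⟩ := hp'
    rw [det_zero_of_column_eq hne fun l => by simp [hij], zero_mul]
  have h3 (e : Fin k ↪o Fin n) : (M.submatrix id e).det * (N.submatrix e id).det
      = ∑ σ : Equiv.Perm (Fin k), (M.submatrix id (e ∘ σ)).det * ∏ i, N ((e ∘ σ) i) i := by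
    rw [det_apply' (N.submatrix e id), Finset.mul_sum]
    refine Finset.sum_congr rfl fun σ _ => ?_
    have : M.submatrix id (e ∘ σ) = (M.submatrix id e).submatrix id σ := rfl
    rw [this, det_permute']
    simp only [submatrix_apply, id, Function.comp_apply]
    ring
  rw [h1, ← h2]
  simp only [h3]
  rw [← Fintype.sum_prod_type']
  symm
  refine Finset.sum_bij (fun x _ => x.1 ∘ x.2) ?_ ?_ ?_ fun _ _ => rfl
  · intro x _
    simpa using x.1.injective.comp x.2.injective
  · rintro ⟨e, σ⟩ _ ⟨e', σ'⟩ _ h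
    simp only at h
    have he : e = e' := by
      rw [← OrderEmbedding.range_inj, ← σ.surjective.range_comp e, h, σ'.surjective.range_comp]
    subst he
    have hσ : σ = σ' := Equiv.ext fun i => e.injective (congrFun h i)
    rw [hσ]
  · intro p hp
    have hp' : Function.Injective p := by simpa using hp
    refine ⟨(OrderEmbedding.ofStrictMono (p ∘ Tuple.sort p)
      ((Tuple.monotone_sort p).strictMono_of_injective
        (hp'.comp (Tuple.sort p).injective)), (Tuple.sort p)⁻¹), Finset.mem_univ _, ?_⟩
    ext i
    simp

/-- An enumeration of the `k`-element subsets of `Fin n`, as order embeddings. -/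
noncomputable def subsetEnum (n k : ℕ) :
    Fin (Fintype.card (Fin k ↪o Fin n)) ≃ (Fin k ↪o Fin n) :=
  (Fintype.equivFin _).symm

/-- The `k`-th compound matrix (antisymmetric tensor power) of `A`, whose entries are the
`k × k` minors of `A`. -/
noncomputable def compound (k : ℕ) (A : Matrix (Fin n) (Fin n) ℂ) :
    Matrix (Fin (Fintype.card (Fin k ↪o Fin n))) (Fin (Fintype.card (Fin k ↪o Fin n))) ℂ :=
  of fun i j => (A.submatrix (subsetEnum n k i) (subsetEnum n k j)).det

lemma compound_mul (k : ℕ) (A B : Matrix (Fin n) (Fin n) ℂ) :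
    compound k (A * B) = compound k A * compound k B := by
  ext i j
  rw [mul_apply]
  simp only [compound, of_apply]
  rw [submatrix_mul A B _ id _ Function.bijective_id, det_mul_eq_sum_orderEmbedding,
    ← Equiv.sum_comp (subsetEnum n k)]
  rfl

lemma compound_star (k : ℕ) (A : Matrix (Fin n) (Fin n) ℂ) :
    compound k (star A) = star (compound k A) := by
  ext i j
  simp only [compound, of_apply, star_eq_conjTranspose, conjTranspose_apply]
  rw [← det_conjTranspose, conjTranspose_submatrix]

lemma compound_diagonal (k : ℕ) (d : Fin n → ℂ) :
    compound k (diagonal d) = diagonal fun i => ∏ l, d (subsetEnum n k i l) := by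
  ext i j
  simp only [compound, of_apply]
  rcases eq_or_ne i j with rfl | hij
  · rw [diagonal_apply_eq, submatrix_diagonal _ _ (subsetEnum n k i).injective, det_diagonal]
    rfl
  · rw [diagonal_apply_ne _ hij]
    obtain ⟨l, hl⟩ : ∃ l, subsetEnum n k i l ∉ Set.range (subsetEnum n k j) := by
      by_contra! h
      refine hij ((subsetEnum n k).injective (OrderEmbedding.range_inj.mp ?_))
      refine Set.eq_of_subset_of_card_le (Set.range_subset_iff.mpr h) ?_
      rw [Set.card_range_of_injective (subsetEnum n k i).injective,
        Set.card_range_of_injective (subsetEnum n k j).injective]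
    refine det_eq_zero_of_row_eq_zero l fun m => ?_
    rw [submatrix_apply, diagonal_apply_ne]
    exact fun h => hl ⟨m, h.symm⟩

lemma compound_one (k : ℕ) : compound k (1 : Matrix (Fin n) (Fin n) ℂ) = 1 := by
  rw [← diagonal_one, compound_diagonal]
  simp

lemma compound_mem_unitary (k : ℕ) {V : Matrix (Fin n) (Fin n) ℂ}
    (hV : V ∈ unitary (Matrix (Fin n) (Fin n) ℂ)) : compound k V ∈ unitary (Matrix _ _ ℂ) := by
  rw [Unitary.mem_iff] at hV ⊢
  rw [← compound_star, ← compound_mul, ← compound_mul, hV.1, hV.2, compound_one]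
  exact ⟨rfl, rfl⟩

lemma compound_unitary_conj_diagonal (k : ℕ) (V : Matrix (Fin n) (Fin n) ℂ) (d : Fin n → ℝ) :
    compound k (V * diagonal (fun i => (d i : ℂ)) * star V) = compound k V *
      diagonal (fun i => ((∏ l, d (subsetEnum n k i l) : ℝ) : ℂ)) * star (compound k V) := by
  rw [compound_mul, compound_mul, compound_star, compound_diagonal]
  simp

lemma compound_nonneg (k : ℕ) (hA : 0 ≤ A) : 0 ≤ compound k A := by
  obtain ⟨V, _, h⟩ := exists_unitary_eig (nonneg_iff_posSemidef.mp hA)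
  rw [h, compound_unitary_conj_diagonal]
  exact unitary_conj_diagonal_nonneg _ fun i => Finset.prod_nonneg fun l _ => eig_nonneg _ _

lemma compound_isStrictlyPositive (k : ℕ) (hA : IsStrictlyPositive A) :
    IsStrictlyPositive (compound k A) := by
  refine IsUnit.isStrictlyPositive ?_ (compound_nonneg k hA.nonneg)
  obtain ⟨u, hu⟩ := hA.isUnit
  refine IsUnit.of_mul_eq_one (compound k (u⁻¹ : (Matrix (Fin n) (Fin n) ℂ)ˣ)) ?_
  rw [← hu, ← compound_mul, Units.mul_inv, compound_one]

/-- Compounds send a unitary diagonalization to one whose eigenvalues are `k`-fold products, and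
powers commute with products of nonnegative reals. -/
lemma compound_rpow (k : ℕ) (hA : 0 ≤ A) (r : ℝ) : compound k (A ^ r) = compound k A ^ r := by
  obtain ⟨V, hV, h⟩ := exists_unitary_eig (nonneg_iff_posSemidef.mp hA)
  have h0 := eig_nonneg (nonneg_iff_posSemidef.mp hA)
  rw [h, unitary_conj_diagonal_rpow hV h0, compound_unitary_conj_diagonal,
    compound_unitary_conj_diagonal, unitary_conj_diagonal_rpow (compound_mem_unitary k hV)
    fun i => Finset.prod_nonneg fun l _ => h0 _]
  congr 3
  ext i
  rw [Real.finsetProd_rpow _ _ fun l _ => h0 _]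

lemma castLE_le_orderEmbedding {k : ℕ} (hk : k ≤ n) (e : Fin k ↪o Fin n) (l : Fin k) :
    Fin.castLE hk l ≤ e l := by
  obtain ⟨m, hm⟩ := l
  rw [Fin.le_def]
  induction m with
  | zero => exact Nat.zero_le _
  | succ m ih =>
    have h : e ⟨m, by omega⟩ < e ⟨m + 1, hm⟩ := e.strictMono (by simp [Fin.lt_def])
    have := ih (by omega)
    simp only [Fin.val_castLE, Fin.lt_def] at this h ⊢
    omega

/-- The norm is the largest `k`-fold product of eigenvalues at increasing indices. The initial
segment attains it, since the `l`-th chosen index is at least `l`. -/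
lemma norm_compound (hA : A.PosSemidef) {k : ℕ} (hk : k ≤ n) :
    ‖compound k A‖ = ∏ i : Fin n with i.val < k, eig hA i := by
  obtain ⟨V, hV, h⟩ := exists_unitary_eig hA
  have h0 := eig_nonneg hA
  have hprod : ∏ i : Fin n with i.val < k, eig hA i = ∏ l, eig hA (Fin.castLE hk l) := by
    refine (Finset.prod_bij (fun l _ => Fin.castLE hk l) ?_ ?_ ?_ fun _ _ => rfl).symm
    · intro l _; simp
    · intro a _ b _ hab; simpa using hab
    · intro b hb; exact ⟨⟨b, by simpa using hb⟩, by simp, by ext; simp⟩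
  have hV' := compound_mem_unitary k hV
  conv_lhs => rw [h]
  rw [compound_unitary_conj_diagonal, CStarRing.norm_mul_mem_unitary _ (Unitary.star_mem hV'),
    CStarRing.norm_mem_unitary_mul _ hV', l2_opNorm_diagonal, hprod]
  refine le_antisymm ?_ ?_
  · rw [pi_norm_le_iff_of_nonneg (Finset.prod_nonneg fun l _ => h0 _)]
    intro i
    rw [Complex.norm_real, Real.norm_of_nonneg (Finset.prod_nonneg fun l _ => h0 _)]
    refine Finset.prod_le_prod (fun l _ => h0 _) fun l _ => eig_antitone hA (castLE_le_orderEmbedding hk _ l)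
  · let e : Fin k ↪o Fin n := Fin.castLEOrderEmb hk
    refine le_trans (le_of_eq ?_) (norm_le_pi_norm _ ((subsetEnum n k).symm e))
    rw [Complex.norm_real, Real.norm_of_nonneg (Finset.prod_nonneg fun l _ => h0 _)]
    simp [e]

lemma compound_R (k : ℕ) (hA : 0 ≤ A) (hB : 0 ≤ B) (α q : ℝ) :
    compound k (R α q A B) = R α q (compound k A) (compound k B) := by
  have h : 0 ≤ A ^ ((1 - α) / 2 * q) * B ^ (α * q) * A ^ ((1 - α) / 2 * q) :=
    conjugate_nonneg_of_nonneg CFC.rpow_nonneg CFC.rpow_nonneg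
  simp only [R, compound_rpow k h, compound_mul, compound_rpow k hA, compound_rpow k hB]

lemma compound_geomMean (k : ℕ) (hA : 0 ≤ A) (hB : 0 ≤ B) (t : ℝ) :
    compound k (geomMean t A B) = geomMean t (compound k A) (compound k B) := by
  have h : 0 ≤ A ^ (-(1 / 2) : ℝ) * B * A ^ (-(1 / 2) : ℝ) :=
    conjugate_nonneg_of_nonneg hB CFC.rpow_nonneg
  simp only [geomMean, compound_rpow k h, compound_mul, compound_rpow k hA]

lemma compound_SG (k : ℕ) (hA : 0 ≤ A) (hB : 0 ≤ B) (α p : ℝ) :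
    compound k (SG α p A B) = SG α p (compound k A) (compound k B) := by
  rw [SG, compound_rpow k (specGeomMean_nonneg α CFC.rpow_nonneg _)]
  simp only [specGeomMean, compound_mul, compound_rpow k (geomMean_nonneg _ _ _)]
  rw [compound_geomMean k CFC.rpow_nonneg CFC.rpow_nonneg]
  simp only [compound_rpow k CFC.rpow_nonneg, compound_rpow k hA, compound_rpow k hB]
  rfl

theorem logMajorizedBy_SG_R_of_isStrictlyPositive (hA : IsStrictlyPositive A) (hB : 0 ≤ B)
    {α p q : ℝ} (hα : 1 < α) (hp : 0 < p) (hq : 0 < q) (hpq : p / q ≤ α) :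
    LogMajorizedBy (SG α p A B) (R α q A B) (SG_posSemidef α p A B) (R_posSemidef α q A B) := by
  refine ⟨fun k _ hk => ?_, ?_⟩
  · rw [← norm_compound _ hk, ← norm_compound _ hk, compound_SG k hA.nonneg hB,
      compound_R k hA.nonneg hB]
    exact norm_SG_le_norm_R (compound_isStrictlyPositive k hA) (compound_nonneg k hB) hα hp hq hpq
  · rw [← norm_det_eq_prod_eig, ← norm_det_eq_prod_eig, norm_det_SG hA hB (by linarith) hp, norm_det_R hA hB hq]

theorem logMajorizedBy_SG_R (hA : 0 ≤ A) (hB : 0 ≤ B) (h : supp B ≤ supp A)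
    {α p q : ℝ} (hα : 1 < α) (hp : 0 < p) (hq : 0 < q) (hpq : p / q ≤ α) :
    LogMajorizedBy (SG α p A B) (R α q A B) (SG_posSemidef α p A B) (R_posSemidef α q A B) := by
  have := logMajorizedBy_SG_R_of_isStrictlyPositive (unitExtension_isStrictlyPositive hA) hB hα hp
    hq hpq
  simpa only [SG_unitExtension hA hB h hα hp, R_unitExtension hA hB h hα hq] using this

end Compound

/-! ### Continuity of both means in `B`, which enters only through positive powers. -/

section Limits

open Filter Topology

variable {ι : Type*} {l : Filter ι} {n : ℕ}

lemma tendsto_rpow {f : ι → Matrix (Fin n) (Fin n) ℂ} {X : Matrix (Fin n) (Fin n) ℂ}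
    (h : Tendsto f l (𝓝 X)) (hf : ∀ᶠ i in l, 0 ≤ f i) (hX : 0 ≤ X) {r : ℝ} (hr : 0 < r) :
    Tendsto (fun i => f i ^ r) l (𝓝 (X ^ r)) := by
  lift r to NNReal using hr.le
  have hr' : 0 < r := by exact_mod_cast hr
  have hc := CFC.continuousOn_nnrpow (A := Matrix (Fin n) (Fin n) ℂ) r X hX
  simp only [CFC.nnrpow_eq_rpow hr'] at hc
  exact hc.tendsto.comp (tendsto_nhdsWithin_iff.mpr ⟨h, hf⟩)

lemma tendsto_conj_rpow {f : ι → Matrix (Fin n) (Fin n) ℂ} {X : Matrix (Fin n) (Fin n) ℂ}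
    (h : Tendsto f l (𝓝 X)) (hf : ∀ᶠ i in l, 0 ≤ f i) (hX : 0 ≤ X) {r : ℝ} (hr : 0 < r)
    {C : Matrix (Fin n) (Fin n) ℂ} (hC : 0 ≤ C) :
    Tendsto (fun i => (C * f i * C) ^ r) l (𝓝 ((C * X * C) ^ r)) :=
  tendsto_rpow ((h.const_mul C).mul_const C)
    (hf.mono fun _ hi => conjugate_nonneg_of_nonneg hi hC) (conjugate_nonneg_of_nonneg hX hC) hr

lemma tendsto_R {f : ι → Matrix (Fin n) (Fin n) ℂ} {A X : Matrix (Fin n) (Fin n) ℂ}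
    (h : Tendsto f l (𝓝 X)) (hf : ∀ᶠ i in l, 0 ≤ f i) (hX : 0 ≤ X) {α q : ℝ} (hα : 0 < α)
    (hq : 0 < q) : Tendsto (fun i => R α q A (f i)) l (𝓝 (R α q A X)) :=
  tendsto_conj_rpow (tendsto_rpow h hf hX (by positivity)) (.of_forall fun _ => CFC.rpow_nonneg)
    CFC.rpow_nonneg (by positivity) CFC.rpow_nonneg

lemma tendsto_SG {f : ι → Matrix (Fin n) (Fin n) ℂ} {A X : Matrix (Fin n) (Fin n) ℂ}
    (h : Tendsto f l (𝓝 X)) (hf : ∀ᶠ i in l, 0 ≤ f i) (hX : 0 ≤ X) {α p : ℝ} (hα : 0 < α)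
    (hp : 0 < p) : Tendsto (fun i => SG α p A (f i)) l (𝓝 (SG α p A X)) := by
  have h1 : Tendsto (fun i => geomMean (1 / 2) ((A ^ p) ^ (-1 : ℝ)) (f i ^ p)) l
      (𝓝 (geomMean (1 / 2) ((A ^ p) ^ (-1 : ℝ)) (X ^ p))) :=
    ((tendsto_conj_rpow (tendsto_rpow h hf hX hp) (.of_forall fun _ => CFC.rpow_nonneg)
      CFC.rpow_nonneg (by norm_num) CFC.rpow_nonneg).const_mul _).mul_const _
  have h2 := tendsto_rpow h1 (.of_forall fun _ => geomMean_nonneg _ _ _) (geomMean_nonneg _ _ _) hα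
  exact tendsto_rpow ((h2.mul_const _).mul h2)
    (.of_forall fun _ => specGeomMean_nonneg α CFC.rpow_nonneg _)
    (specGeomMean_nonneg α CFC.rpow_nonneg _) (by positivity)

end Limits

/-! ### The two means when `B` is a projection compressing powers of `A` to scalars. -/

section RankOne

variable {n : ℕ} {A P : Matrix (Fin n) (Fin n) ℂ}

lemma rpow_of_isStarProjection (hP : IsStarProjection P) {r : ℝ} (hr : r ≠ 0) : P ^ r = P := by
  rw [CFC.rpow_eq_cfc_real hP.nonneg]
  refine (cfc_congr fun t ht => ?_).trans (cfc_id ℝ P hP.isSelfAdjoint)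
  rcases (isIdempotentElem_iff_spectrum_subset ℝ P hP.isSelfAdjoint).mp hP.isIdempotentElem ht
    with h | h
  · simp [h, hr]
  · simp [Set.mem_singleton_iff.mp h]

lemma rpow_of_mul_self_eq_smul {X : Matrix (Fin n) (Fin n) ℂ} (hX : 0 ≤ X) {c : ℝ} (hc : 0 < c)
    (h : X * X = c • X) {r : ℝ} (hr : r ≠ 0) : X ^ r = c ^ (r - 1) • X := by
  have hQ : IsStarProjection (c⁻¹ • X) := by
    refine ⟨?_, (smul_nonneg (inv_nonneg.mpr hc.le) hX).isSelfAdjoint⟩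
    rw [IsIdempotentElem, smul_mul_smul_comm, h, smul_smul]
    congr 1
    field_simp
  have hX' : X = c • (c⁻¹ • X) := by rw [smul_smul, mul_inv_cancel₀ hc.ne', one_smul]
  conv_lhs => rw [hX', smul_rpow hQ.nonneg hc.le, rpow_of_isStarProjection hQ hr, smul_smul]
  rw [Real.rpow_sub_one hc.ne', div_eq_mul_inv]

lemma norm_of_isStarProjection (hP : IsStarProjection P) (h0 : P ≠ 0) : ‖P‖ = 1 := by
  have h := CStarRing.norm_star_mul_self (x := P)
  rw [hP.isSelfAdjoint.star_eq, hP.isIdempotentElem.eq] at h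
  exact (mul_eq_right₀ (norm_ne_zero_iff.mpr h0)).mp h.symm

/-- With `T = P A^((1-α)q/2)`, the matrix inside the outer power is `T* T`, whose norm is that of `T
T* = b P`. -/
lemma norm_R_of_isStarProjection (hP : IsStarProjection P) (h0 : P ≠ 0) {α q b : ℝ}
    (hα : 1 < α) (hq : 0 < q) (hb : 0 ≤ b) (h : P * A ^ ((1 - α) * q) * P = b • P) :
    ‖R α q A P‖ = b ^ (1 / q) := by
  have hs : (1 - α) * q ≠ 0 := mul_ne_zero (by linarith) hq.ne'
  have hn : 0 ≤ A ^ ((1 - α) / 2 * q) * P * A ^ ((1 - α) / 2 * q) :=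
    conjugate_nonneg_of_nonneg hP.nonneg CFC.rpow_nonneg
  rw [R, rpow_of_isStarProjection hP (by positivity), CFC.norm_rpow _ (by positivity) hn]
  congr 1
  set T := P * A ^ ((1 - α) / 2 * q) with hT
  have hTs : star T = A ^ ((1 - α) / 2 * q) * P := by
    rw [hT, star_mul, star_rpow, hP.isSelfAdjoint.star_eq]
  have h1 : star T * T = A ^ ((1 - α) / 2 * q) * P * A ^ ((1 - α) / 2 * q) := by
    rw [hTs, hT, mul_assoc, ← mul_assoc P, hP.isIdempotentElem.eq, mul_assoc]
  have h2 : T * star T = b • P := by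
    rw [hTs, hT, ← h, ← rpow_mul_rpow (A := A) (x := (1 - α) / 2 * q) (y := (1 - α) / 2 * q)
      (by ring) hs]
    noncomm_ring
  rw [← h1, CStarRing.norm_star_mul_self, ← CStarRing.norm_self_mul_star, h2, norm_smul,
    norm_of_isStarProjection hP h0, mul_one, Real.norm_of_nonneg hb]

/-- `M = A^(p/2) P A^(p/2)` satisfies `M² = a M`, so `M^(1/2) = a^(-1/2) M` and the geometric mean
collapses to `a^(-1/2) P`. Hence `F_α = a^(-α) P A^p P = a^(1-α) P`. -/
lemma SG_of_isStarProjection (hA : IsStrictlyPositive A) (hP : IsStarProjection P) {α p a : ℝ}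
    (hα : 0 < α) (hp : 0 < p) (ha : 0 < a) (h : P * A ^ p * P = a • P) :
    SG α p A P = (a ^ (1 - α)) ^ (1 / p) • P := by
  have hA' := rpow_isStrictlyPositive hA p
  have hM : 0 ≤ (A ^ p) ^ (1 / 2 : ℝ) * P * (A ^ p) ^ (1 / 2 : ℝ) :=
    conjugate_nonneg_of_nonneg hP.nonneg CFC.rpow_nonneg
  have hA1 : (A ^ p) ^ (1 / 2 : ℝ) * (A ^ p) ^ (1 / 2 : ℝ) = A ^ p := by
    rw [rpow_mul_rpow (z := 1) (by norm_num) one_ne_zero, CFC.rpow_one _ CFC.rpow_nonneg]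
  have hMM : (A ^ p) ^ (1 / 2 : ℝ) * P * (A ^ p) ^ (1 / 2 : ℝ)
        * ((A ^ p) ^ (1 / 2 : ℝ) * P * (A ^ p) ^ (1 / 2 : ℝ))
      = a • ((A ^ p) ^ (1 / 2 : ℝ) * P * (A ^ p) ^ (1 / 2 : ℝ)) := by
    calc _ = (A ^ p) ^ (1 / 2 : ℝ) * (P * ((A ^ p) ^ (1 / 2 : ℝ) * (A ^ p) ^ (1 / 2 : ℝ)) * P)
          * (A ^ p) ^ (1 / 2 : ℝ) := by noncomm_ring
      _ = _ := by rw [hA1, h, mul_smul_comm, smul_mul_assoc]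
  have hG : geomMean (1 / 2) ((A ^ p) ^ (-1 : ℝ)) (P ^ p) = a ^ (-(1 / 2) : ℝ) • P := by
    rw [geomMean_half_inv CFC.rpow_nonneg, rpow_of_isStarProjection hP hp.ne',
      rpow_of_mul_self_eq_smul hM ha hMM (by norm_num), mul_smul_comm, smul_mul_assoc]
    have := conj_rpow_mul_conj (x := -(1 / 2)) hA' P
    rw [neg_neg] at this
    rw [this]
    norm_num
  have hn : 0 ≤ a ^ (-(1 / 2) : ℝ) := by positivity
  rw [SG, specGeomMean, hG, smul_rpow hP.nonneg hn, rpow_of_isStarProjection hP hα.ne']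
  simp only [smul_mul_assoc, mul_smul_comm, h, smul_smul]
  rw [smul_rpow hP.nonneg (by positivity), rpow_of_isStarProjection hP (by positivity)]
  congr 2
  rw [← Real.rpow_mul ha.le, ← Real.rpow_add_one ha.ne', ← Real.rpow_add ha]
  congr 1
  ring

end RankOne

/-! ### The `2 × 2` counterexample to the reverse relation. -/

section Counterexample

open Matrix Filter Topology

lemma norm_eq_prod_eig_lt_one {X : Matrix (Fin 2) (Fin 2) ℂ} (hX : X.PosSemidef) :
    ‖X‖ = ∏ i : Fin 2 with i.val < 1, eig hX i := by
  obtain ⟨V, hV, h⟩ := exists_unitary_eig hX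
  have h0 := eig_nonneg hX
  have h10 : eig hX 1 ≤ eig hX 0 := eig_antitone hX (Fin.zero_le _)
  have hf : (Finset.univ.filter fun i : Fin 2 => i.val < 1) = {0} := by decide
  conv_lhs => rw [h]
  rw [CStarRing.norm_mul_mem_unitary _ (Unitary.star_mem hV), CStarRing.norm_mem_unitary_mul _ hV,
    l2_opNorm_diagonal, hf, Finset.prod_singleton]
  refine le_antisymm ((pi_norm_le_iff_of_nonneg (h0 0)).mpr fun i => ?_) ?_
  · rw [Complex.norm_real, Real.norm_of_nonneg (h0 i)]
    fin_cases i
    exacts [le_rfl, h10]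
  · refine le_trans (le_of_eq ?_) (norm_le_pi_norm _ 0)
    rw [Complex.norm_real, Real.norm_of_nonneg (h0 0)]

/-- Strict AM–GM for `1` and `2^x`. -/
lemma two_rpow_half_lt {x : ℝ} (hx : x ≠ 0) : (2 : ℝ) ^ (x / 2) < (1 + 2 ^ x) / 2 := by
  have h1 : (2 : ℝ) ^ x = 2 ^ (x / 2) * 2 ^ (x / 2) := by
    rw [← Real.rpow_add two_pos, add_halves]
  have h2 : (2 : ℝ) ^ (x / 2) ≠ 1 := by
    rcases hx.lt_or_gt with h | h
    · exact (Real.rpow_lt_one_of_one_lt_of_neg one_lt_two (by linarith)).ne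
    · exact (Real.one_lt_rpow one_lt_two (by linarith)).ne'
  have h3 : 0 < ((2 : ℝ) ^ (x / 2) - 1) ^ 2 := sq_pos_of_ne_zero (sub_ne_zero.mpr h2)
  nlinarith

/-- The projection of `ℂ²` onto the span of `(1, 1)`. -/
noncomputable def diagProj : Matrix (Fin 2) (Fin 2) ℂ := !![1 / 2, 1 / 2; 1 / 2, 1 / 2]

lemma diagProj_isStarProjection : IsStarProjection diagProj := by
  refine ⟨?_, ?_⟩
  · rw [IsIdempotentElem, diagProj]
    ext i j
    fin_cases i <;> fin_cases j <;> norm_num [mul_apply]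
  · rw [IsSelfAdjoint, diagProj, star_eq_conjTranspose]
    ext i j
    fin_cases i <;> fin_cases j <;> simp

lemma diagProj_ne_zero : diagProj ≠ 0 := fun h => by
  have := congrFun (congrFun h 0) 0
  simp [diagProj] at this

lemma diagonal_one_two_posDef : (diagonal ![(1 : ℂ), 2]).PosDef := by
  refine PosDef.diagonal fun i => ?_
  fin_cases i <;> simp

lemma diagProj_conj_rpow (x : ℝ) : diagProj * (diagonal ![(1 : ℂ), 2]) ^ x * diagProj
    = ((1 + 2 ^ x) / 2 : ℝ) • diagProj := by
  have h := unitary_conj_diagonal_rpow (one_mem (unitary (Matrix (Fin 2) (Fin 2) ℂ)))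
    (d := ![1, 2]) (fun i => by fin_cases i <;> simp) x
  have hd : diagonal (fun i => ((![1, 2] : Fin 2 → ℝ) i : ℂ)) = diagonal ![(1 : ℂ), 2] := by
    congr 1
    ext i
    fin_cases i <;> simp
  rw [one_mul, star_one, mul_one, one_mul, mul_one, hd] at h
  rw [h, diagProj]
  ext i j
  fin_cases i <;> fin_cases j <;>
    (simp [mul_apply, Fin.sum_univ_two, vecMul_diagonal]; ring)

theorem exists_not_logMajorizedBy_R_SG {α p q : ℝ} (hα : 1 < α) (hp : 0 < p) (hq : 0 < q) :
    ∃ A B : Matrix (Fin 2) (Fin 2) ℂ, A.PosDef ∧ B.PosDef ∧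
      ¬ LogMajorizedBy (R α q A B) (SG α p A B) (R_posSemidef α q A B) (SG_posSemidef α p A B) := by
  by_contra! hcon
  have hα0 : 0 < α := by linarith
  set A : Matrix (Fin 2) (Fin 2) ℂ := diagonal ![(1 : ℂ), 2] with hAdef
  have hA : A.PosDef := diagonal_one_two_posDef
  have hP := diagProj_isStarProjection
  -- `P` is singular, so it is approached by positive definite matrices and only the weak norm
  -- inequality survives in the limit; strict AM–GM contradicts even that.
  let f : ℝ → Matrix (Fin 2) (Fin 2) ℂ := fun ε => diagProj + ε • 1
  have hf : ∀ ε : ℝ, 0 < ε → (f ε).PosDef := fun ε hε =>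
    PosDef.posSemidef_add (nonneg_iff_posSemidef.mp hP.nonneg) (PosDef.one.smul hε)
  have hlim : Tendsto f (𝓝[>] 0) (𝓝 diagProj) := by
    have h : Continuous f := by fun_prop
    have := (h.tendsto 0).mono_left (nhdsWithin_le_nhds (s := Set.Ioi 0))
    simpa [f] using this
  have hpos : ∀ᶠ ε in 𝓝[>] (0 : ℝ), 0 ≤ f ε :=
    eventually_mem_nhdsWithin.mono fun ε hε => nonneg_iff_posSemidef.mpr (hf ε hε).posSemidef
  have hle : ‖R α q A diagProj‖ ≤ ‖SG α p A diagProj‖ := by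
    refine le_of_tendsto_of_tendsto (tendsto_R hlim hpos hP.nonneg hα0 hq).norm
      (tendsto_SG hlim hpos hP.nonneg hα0 hp).norm (eventually_mem_nhdsWithin.mono fun ε hε => ?_)
    have := (hcon A (f ε) hA (hf ε hε)).1 1 le_rfl one_le_two
    rwa [← norm_eq_prod_eig_lt_one, ← norm_eq_prod_eig_lt_one] at this
  have hs : (1 - α) * q ≠ 0 := mul_ne_zero (by linarith) hq.ne'
  have ha := two_rpow_half_lt hp.ne'
  have hb := two_rpow_half_lt hs
  rw [norm_R_of_isStarProjection hP diagProj_ne_zero hα hq (by positivity) (diagProj_conj_rpow _),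
    SG_of_isStarProjection hA.isStrictlyPositive hP hα0 hp (by positivity) (diagProj_conj_rpow _),
    norm_smul, norm_of_isStarProjection hP diagProj_ne_zero, mul_one,
    Real.norm_of_nonneg (by positivity)] at hle
  have h1 : (2 : ℝ) ^ ((1 - α) / 2) < ((1 + 2 ^ ((1 - α) * q)) / 2) ^ (1 / q) := by
    refine lt_of_eq_of_lt ?_ (Real.rpow_lt_rpow (by positivity) hb (one_div_pos.mpr hq))
    rw [← Real.rpow_mul two_pos.le]
    congr 1
    field_simp
  -- The negative exponent `1 - α` reverses AM–GM here, so `SG` falls below the common value while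
  -- `R` stays above it.
  have h2 : ((((1 : ℝ) + 2 ^ p) / 2) ^ (1 - α)) ^ (1 / p) < 2 ^ ((1 - α) / 2) := by
    refine (Real.rpow_lt_rpow (by positivity) (Real.rpow_lt_rpow_of_neg (by positivity) ha
      (by linarith)) (one_div_pos.mpr hp)).trans_eq ?_
    rw [← Real.rpow_mul two_pos.le, ← Real.rpow_mul two_pos.le]
    congr 1
    field_simp
  exact absurd hle (not_le.mpr (h2.trans h1))

end Counterexample

end QuasiMeans

theorem theorem3p4 (α p q : ℝ) (hα : 1 < α) (hp : 0 < p) (hq : 0 < q) :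
    (p / q ≤ α →
      ∀ (n : ℕ) (A B : Matrix (Fin n) (Fin n) ℂ), A.PosSemidef → B.PosSemidef →
        QuasiMeans.supp B ≤ QuasiMeans.supp A →
        QuasiMeans.LogMajorizedBy (QuasiMeans.SG α p A B) (QuasiMeans.R α q A B)
          (QuasiMeans.SG_posSemidef α p A B) (QuasiMeans.R_posSemidef α q A B)) ∧
    (∃ A B : Matrix (Fin 2) (Fin 2) ℂ, A.PosDef ∧ B.PosDef ∧
      ¬ QuasiMeans.LogMajorizedBy (QuasiMeans.R α q A B) (QuasiMeans.SG α p A B)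
          (QuasiMeans.R_posSemidef α q A B) (QuasiMeans.SG_posSemidef α p A B)) :=
  ⟨fun hpq _ _ _ hA hB h => QuasiMeans.logMajorizedBy_SG_R (Matrix.nonneg_iff_posSemidef.mpr hA)
    (Matrix.nonneg_iff_posSemidef.mpr hB) h hα hp hq hpq,
    QuasiMeans.exists_not_logMajorizedBy_R_SG hα hp hq⟩
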